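/- Let $K$ be a (commutative) discretely valued field with valuation ring $\mathcal{O}_K$, uniformizer $\pi$ and maximal ideal $\mathfrak{m}_K=\pi\mathcal{O}_K\neq\{0\}$; neither completeness of $K$ nor finiteness of the residue field is assumed. A lattice in a finite-dimensional $K$-vector space $V$ is a free $\mathcal{O}_K$-submodule of rank $\dim_K V$; the class of a lattice $L$ is $[L]=\{cL : c\in K\setminus\{0\}\}$. An order in $K^{2\times 2}$ is a lattice in $K^{2\times 2}$ that is a subring containing the identity. For an order $\Lambda$ let $Q(\Lambda)$ be the set of classes $[L]$ of lattices $L\subset K^2$ with $\Lambda L=L$. For a set $\mathcal{L}$ of classes of lattices in $K^2$ let $\mathrm{PZ}(\mathcal{L})=\bigcap_{[L]\in\mathcal{L}}\mathrm{End}_{\mathcal{O}_K}(L)\subseteq K^{2\times 2}$. The order $\Lambda$ is closed if $\Lambda=\mathrm{PZ}(Q(\Lambda))$. The distance $\mathrm{dist}([L_1],[L_2])$ is the least $s\ge 0$ such that $\pi^sL_1'\subseteq L_2'\subseteq L_1'$ for some $L_1'\in[L_1]$, $L_2'\in[L_2]$. Given a basis $(e_1,e_2)$ of $K^2$, with respect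 to which matrices are written, and an integer matrix $M$ with $M_{ii}=0$ and $M_{ij}+M_{jk}\ge M_{ik}$ for all $i,j,k$, put $\Lambda(M)=\{X : X_{ij}\in\mathfrak{m}_K^{M_{ij}} \text{ for all } i,j\}$ and, for $r\ge 0$, let the bolytrope order be $\mathbb{B}_r(M)=\mathrm{PZ}(\{[L] : \mathrm{dist}([L],[L'])\le r \text{ for some } [L']\in Q(\Lambda(M))\})$. Theorem. Let $\Lambda$ be a closed order in $K^{2\times 2}$. Then there are a basis of $K^2$ and integers $r,m\ge 0$ such that, with all matrices written with respect to this basis, $$\Lambda=\mathbb{B}_r\left(\begin{pmatrix}0&m\\0&0\end{pmatrix}\right)=\{X\in\mathcal{O}_K^{2\times 2} : X_{12}\in\mathfrak{m}_K^{m+r},\ X_{21}\in\mathfrak{m}_K^{r},\ X_{11}\equiv X_{22} \bmod \pi^r\}.$$ -/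

import Mathlib

open scoped Pointwise

namespace Bolytrope

variable {O K : Type*} [CommRing O] [Field K] [Algebra O K] {d : ℕ}

/-- The power `𝔪_K ^ k = π ^ k O_K`, `k ∈ ℤ`, of the maximal ideal of the valuation ring `O`,
as an `O`-submodule of `K`. -/
def mPow (K : Type*) [Field K] [Algebra O K] (π : O) (k : ℤ) : Submodule O K :=
  Submodule.span O {algebraMap O K π ^ k}

/-- The matrix of (the endomorphism of `K ^ d` given by) `X` with respect to the basis `b`. -/
noncomputable def coords (b : Module.Basis (Fin d) K (Fin d → K)) (X : Matrix (Fin d) (Fin d) K) :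
    Matrix (Fin d) (Fin d) K :=
  LinearMap.toMatrix b b (Matrix.toLin' X)

theorem coords_add (b : Module.Basis (Fin d) K (Fin d → K)) (X Y : Matrix (Fin d) (Fin d) K) :
    coords b (X + Y) = coords b X + coords b Y := by
  simp [coords]

theorem coords_mul (b : Module.Basis (Fin d) K (Fin d → K)) (X Y : Matrix (Fin d) (Fin d) K) :
    coords b (X * Y) = coords b X * coords b Y := by
  simp [coords, Matrix.toLin'_mul, LinearMap.toMatrix_comp b b b]

theorem coords_algebraMap (b : Module.Basis (Fin d) K (Fin d → K)) (a : O) :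
    coords b (algebraMap O (Matrix (Fin d) (Fin d) K) a) =
      algebraMap O (Matrix (Fin d) (Fin d) K) a := by
  have h : algebraMap O (Matrix (Fin d) (Fin d) K) a
      = algebraMap O K a • (1 : Matrix (Fin d) (Fin d) K) := by
    rw [algebraMap_smul, Algebra.algebraMap_eq_smul_one]
  rw [h, coords, map_smul, map_smul, Matrix.toLin'_one, LinearMap.toMatrix_id]

/-! ### Lattices, homothety classes, orders -/

/-- `O`-lattices in `K ^ d`: the finitely generated `O`-submodules that span `K ^ d` over `K`. Over
a discrete valuation ring these are the free `O`-submodules of rank `d`. -/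
def Latt (O K : Type*) [CommRing O] [Field K] [Algebra O K] (d : ℕ) : Type _ :=
  {L : Submodule O (Fin d → K) // Submodule.IsLattice K L}

/-- Homothety of lattices. -/
def homothety (O K : Type*) [CommRing O] [Field K] [Algebra O K] (d : ℕ) :
    Setoid (Latt O K d) where
  r L L' := ∃ c : K, c ≠ 0 ∧ L'.1 = c • L.1
  iseqv :=
    { refl := fun L => ⟨1, one_ne_zero, (one_smul K L.1).symm⟩
      symm := by
        rintro L L' ⟨c, hc, h⟩
        exact ⟨c⁻¹, inv_ne_zero hc, by rw [h, smul_smul, inv_mul_cancel₀ hc, one_smul]⟩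
      trans := by
        rintro L L' L'' ⟨c, hc, h⟩ ⟨c', hc', h'⟩
        exact ⟨c' * c, mul_ne_zero hc' hc, by rw [h', h, smul_smul]⟩ }

/-- The vertices of the affine building: homothety classes of lattices in `K ^ d`. -/
def Vertex (O K : Type*) [CommRing O] [Field K] [Algebra O K] (d : ℕ) : Type _ :=
  Quotient (homothety O K d)

/-- The homothety class `[L]`. -/
def Latt.cls (L : Latt O K d) : Vertex O K d := Quotient.mk (homothety O K d) L

/-- An `O`-order in `K ^ (d × d)`: a lattice that is also a (unital) subring. -/
def IsOrder (Λ : Subalgebra O (Matrix (Fin d) (Fin d) K)) : Prop :=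
  Submodule.IsLattice K (Subalgebra.toSubmodule Λ)

/-- `End_O(L)`, as a subring of `K ^ (d × d)`. -/
def endOrder (L : Latt O K d) : Subalgebra O (Matrix (Fin d) (Fin d) K) where
  carrier := {X | ∀ v ∈ L.1, X.mulVec v ∈ L.1}
  mul_mem' := by
    intro X Y hX hY v hv
    rw [← Matrix.mulVec_mulVec]
    exact hX _ (hY v hv)
  add_mem' := by
    intro X Y hX hY v hv
    rw [Matrix.add_mulVec]
    exact L.1.add_mem (hX v hv) (hY v hv)
  algebraMap_mem' := by
    intro a v hv
    rw [Algebra.algebraMap_eq_smul_one, Matrix.smul_mulVec, Matrix.one_mulVec]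
    exact L.1.smul_mem a hv

/-- `Q(Λ)`: the set of homothety classes of `Λ`-lattices, i.e. of the lattices stable under `Λ`. -/
def Q (Λ : Subalgebra O (Matrix (Fin d) (Fin d) K)) : Set (Vertex O K d) :=
  {x | ∃ L : Latt O K d, L.cls = x ∧ ∀ X ∈ Λ, ∀ v ∈ L.1, X.mulVec v ∈ L.1}

/-- The Plesken–Zassenhaus order of a set of lattice classes: the intersection of the endomorphism
rings of the lattices in these classes. -/
def PZ (S : Set (Vertex O K d)) : Subalgebra O (Matrix (Fin d) (Fin d) K) :=
  ⨅ (L : Latt O K d) (_ : L.cls ∈ S), endOrder L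

/-- Closed orders. -/
def IsClosedOrder (Λ : Subalgebra O (Matrix (Fin d) (Fin d) K)) : Prop :=
  IsOrder Λ ∧ Λ = PZ (Q Λ)

/-! ### Distance and balls -/

/-- The distance of two lattice classes. -/
noncomputable def vdist (π : O) (x y : Vertex O K d) : ℕ :=
  sInf {s : ℕ | ∃ L L' : Latt O K d, L.cls = x ∧ L'.cls = y ∧ π ^ s • L.1 ≤ L'.1 ∧ L'.1 ≤ L.1}

/-- The closed ball of radius `r` around a set of lattice classes: the classes whose minimal
distance to a member of the set is at most `r`. -/
def ball (π : O) (r : ℕ) (S : Set (Vertex O K d)) : Set (Vertex O K d) :=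
  {x | ∃ y ∈ S, vdist π x y ≤ r}

/-! ### Graduated orders and bolytrope orders -/

/-- The integral points of the polytrope region. -/
def polytropeRegion (d : ℕ) : Set (Matrix (Fin d) (Fin d) ℤ) :=
  {M | (∀ i, M i i = 0) ∧ ∀ i j k, M i k ≤ M i j + M j k}

theorem mPow_mul_mem {π : O} {k l n : ℤ} (hπ : algebraMap O K π ≠ 0) (h : n ≤ k + l) {x y : K}
    (hx : x ∈ mPow K π k) (hy : y ∈ mPow K π l) : x * y ∈ mPow K π n := by
  obtain ⟨a, rfl⟩ := Submodule.mem_span_singleton.1 hx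
  obtain ⟨c, rfl⟩ := Submodule.mem_span_singleton.1 hy
  obtain ⟨t, ht⟩ := Int.le.dest h
  refine Submodule.mem_span_singleton.2 ⟨a * c * π ^ t, ?_⟩
  have e : algebraMap O K π ^ k * algebraMap O K π ^ l
      = algebraMap O K π ^ n * algebraMap O K π ^ t := by
    rw [← zpow_add₀ hπ, ← ht, zpow_add₀ hπ, zpow_natCast]
  simp only [Algebra.smul_def, map_mul, map_pow]
  linear_combination (-(algebraMap O K a * algebraMap O K c)) * e

theorem irreducible_map_ne_zero [IsDomain O] [IsFractionRing O K] {π : O} (hπ : Irreducible π) :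
    algebraMap O K π ≠ 0 := by
  simpa using hπ.ne_zero

/-- The graduated order with exponent matrix `M`, with respect to the basis `b`: all `X` whose
matrix with respect to `b` has `(i, j)` entry in `𝔪_K ^ (M i j)`. -/
noncomputable def graduatedOrder [IsDomain O] [IsFractionRing O K] {π : O} (hπ : Irreducible π)
    (b : Module.Basis (Fin d) K (Fin d → K)) (M : polytropeRegion d) :
    Subalgebra O (Matrix (Fin d) (Fin d) K) where
  carrier := {X | ∀ i j, coords b X i j ∈ mPow K π (M.1 i j)}
  mul_mem' := by
    intro X Y hX hY i k
    rw [coords_mul, Matrix.mul_apply]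
    exact Submodule.sum_mem _ fun j _ =>
      mPow_mul_mem (irreducible_map_ne_zero hπ) (M.2.2 i j k) (hX i j) (hY j k)
  add_mem' := by
    intro X Y hX hY i j
    rw [coords_add]
    exact Submodule.add_mem _ (hX i j) (hY i j)
  algebraMap_mem' := by
    intro a i j
    rw [coords_algebraMap, Matrix.algebraMap_matrix_apply]
    split_ifs with h
    · subst h
      rw [M.2.1 i]
      exact Submodule.mem_span_singleton.2 ⟨a, by simp [Algebra.smul_def]⟩
    · exact Submodule.zero_mem _

/-- The bolytrope with center `Q(Λ(M))` and radius `r`, with respect to the basis `b`. -/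
def bolytrope [IsDomain O] [IsFractionRing O K] {π : O} (hπ : Irreducible π)
    (b : Module.Basis (Fin d) K (Fin d → K)) (r : ℕ) (M : polytropeRegion d) :
    Set (Vertex O K d) :=
  ball π r (Q (graduatedOrder hπ b M))

/-- The bolytrope order with exponent matrix `M` and radius `r`, with respect to the basis `b`. -/
def bolytropeOrder [IsDomain O] [IsFractionRing O K] {π : O} (hπ : Irreducible π)
    (b : Module.Basis (Fin d) K (Fin d → K)) (r : ℕ) (M : polytropeRegion d) :
    Subalgebra O (Matrix (Fin d) (Fin d) K) :=
  PZ (bolytrope hπ b r M)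

/-- The exponent matrix `(0 m; 0 0)`, `m ≥ 0`. -/
def upperExponent (m : ℕ) : polytropeRegion 2 :=
  ⟨!![0, (m : ℤ); 0, 0], by
    refine ⟨fun i => by fin_cases i <;> simp, fun i j k => ?_⟩
    fin_cases i <;> fin_cases j <;> fin_cases k <;> simp⟩

end Bolytrope

open scoped Pointwise

namespace Bolytrope

/-! ### Powers of the maximal ideal. -/

section Powers

variable {O K : Type*} [CommRing O] [Field K] [Algebra O K] {π : O}

/-! Homothety classes of lattices in `K²` are the vertices of a tree. For a basis `(e₁, e₂)` the
lattices `⟨e₁, π ^ c e₂⟩` with `0 ≤ c ≤ E` form a path of length `E`, and `Λ` stabilizes all of them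
exactly when its matrices are upper triangular modulo `π ^ E`. Determinants of commutators bound the
length of such a path (`IsOrder.exists_bound`), so there is a longest one, of length `D`.

Up to homothety every lattice is `⟨e₁ + t e₂, π ^ c e₂⟩` (`exists_stabilizesNormal_iff`). If `t ∈ 𝔪
^ c` it is in the apartment of the basis and, if stable, on the path. Otherwise it leaves the
apartment at the vertex `k = v(t)` and lies `c - k` steps off it. Joining a stable lattice of this
kind to an end of the path gives another stable path; by maximality `c - k` is at most the distance
from the branch point to either end (`exponent_bounds_of_maximal`). For matrices upper triangular
modulo `π ^ D`, stability of such a lattice then amounts to `X₁₁ ≡ X₂₂ mod π ^ (c - k)`. A closed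
order is determined by its stable lattices, hence by `D` and the largest `r ≤ D / 2` for which this
congruence modulo `π ^ r` holds throughout (`IsClosedOrder.exists_mem_iff`).

Trimming `r` steps from both ends of the path leaves the center, of length `m = D - 2r`. On the
other side, the bolytrope order is `O + π ^ r Λ(M)` (`mem_bolytropeOrder_upperExponent`), which has
the same entrywise description. -/

theorem mem_mPow_zero {x : K} : x ∈ mPow K π 0 ↔ x ∈ (algebraMap O K).range := by
  simp [mPow, Submodule.mem_span_singleton, Algebra.smul_def]

theorem one_mem_mPow_zero : (1 : K) ∈ mPow K π 0 := mem_mPow_zero.2 (Subring.one_mem _)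

theorem zpow_mem_mPow (k : ℤ) : algebraMap O K π ^ k ∈ mPow K π k :=
  Submodule.mem_span_singleton_self _

variable [IsDomain O] [IsFractionRing O K]

theorem mPow_antitone (hπ : Irreducible π) {k l : ℤ} (h : k ≤ l) {x : K} (hx : x ∈ mPow K π l) :
    x ∈ mPow K π k := by
  simpa using mPow_mul_mem (irreducible_map_ne_zero hπ) (l := 0) (by simpa using h) hx
    one_mem_mPow_zero

theorem zpow_mul_mem_mPow_iff (hπ : Irreducible π) {k n : ℤ} {x : K} :
    algebraMap O K π ^ k * x ∈ mPow K π n ↔ x ∈ mPow K π (n - k) := by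
  have h0 : algebraMap O K π ≠ 0 := irreducible_map_ne_zero hπ
  constructor
  · intro h
    have := mPow_mul_mem h0 (n := n - k) (by lia) (zpow_mem_mPow (-k)) h
    rwa [← mul_assoc, ← zpow_add₀ h0, neg_add_cancel, zpow_zero, one_mul] at this
  · intro h
    exact mPow_mul_mem h0 (by lia) (zpow_mem_mPow k) h

/-- The powers of the maximal ideal are strictly decreasing. -/
theorem nonpos_of_one_mem_mPow (hπ : Irreducible π) {k : ℤ} (h : (1 : K) ∈ mPow K π k) :
    k ≤ 0 := by
  by_contra! hk
  obtain ⟨a, ha⟩ := mem_mPow_zero.1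
    ((zpow_mul_mem_mPow_iff hπ (k := -1) (n := 0)).2 (mPow_antitone hπ (by lia) h))
  have h0 : algebraMap O K π ≠ 0 := irreducible_map_ne_zero hπ
  refine hπ.not_isUnit (IsUnit.of_mul_eq_one a (IsFractionRing.injective O K ?_))
  rw [map_mul, ha, map_one]
  simp [h0]

/-- The integer `k` is the valuation of `x`. Having both `x ∈ 𝔪 ^ k` and `x⁻¹ ∈ 𝔪 ^ (-k)` allows `x`
to be multiplied in and cancelled without any loss of exponent. -/
theorem exists_mem_mPow_inv_mem [IsDiscreteValuationRing O] (hπ : Irreducible π) {x : K}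
    (hx : x ≠ 0) : ∃ k : ℤ, x ∈ mPow K π k ∧ x⁻¹ ∈ mPow K π (-k) ∧
      ∃ u ∈ mPow K π 0, u⁻¹ ∈ mPow K π 0 ∧ u ≠ 0 ∧ x = algebraMap O K π ^ k * u := by
  obtain ⟨k, u, rfl⟩ := IsDiscreteValuationRing.exists_units_eq_smul_zpow_of_irreducible hπ hx
  have e : (algebraMap O K (u : O))⁻¹ = algebraMap O K (↑u⁻¹ : O) := by
    refine inv_eq_of_mul_eq_one_right ?_
    rw [← map_mul, Units.mul_inv, map_one]
  refine ⟨k, ?_, ?_, algebraMap O K u, mem_mPow_zero.2 ⟨_, rfl⟩,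
    mem_mPow_zero.2 ⟨_, e.symm⟩, by simp, ?_⟩
  · exact Submodule.smul_mem _ (u : O) (zpow_mem_mPow k)
  · have : (u • algebraMap O K π ^ k)⁻¹ = (↑u⁻¹ : O) • algebraMap O K π ^ (-k) := by
      rw [Units.smul_def, Algebra.smul_def, mul_inv, e, Algebra.smul_def, zpow_neg]
    rw [this]
    exact Submodule.smul_mem _ _ (zpow_mem_mPow _)
  · rw [Units.smul_def, Algebra.smul_def, mul_comm]

end Powers

/-! ### Change of basis. -/

section Coordinates

variable {K : Type*} [Field K]

theorem toMatrix_mul_coords {d : ℕ} (b b' : Module.Basis (Fin d) K (Fin d → K))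
    (X : Matrix (Fin d) (Fin d) K) :
    b.toMatrix b' * coords b' X = coords b X * b.toMatrix b' := by
  rw [coords, coords, basis_toMatrix_mul_linearMap_toMatrix,
    linearMap_toMatrix_mul_basis_toMatrix]

theorem det_coords {d : ℕ} (b : Module.Basis (Fin d) K (Fin d → K))
    (X : Matrix (Fin d) (Fin d) K) : (coords b X).det = X.det := by
  rw [coords, LinearMap.det_toMatrix, LinearMap.det_toLin']

/-- The basis whose members have the columns of `T` as coordinates with respect to `b`. -/
theorem exists_basis_toMatrix_eq {d : ℕ} (b : Module.Basis (Fin d) K (Fin d → K))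
    {T S : Matrix (Fin d) (Fin d) K} (h : T * S = 1) :
    ∃ b' : Module.Basis (Fin d) K (Fin d → K), b.toMatrix b' = T ∧ b'.toMatrix b = S ∧
      ∀ X, coords b' X = S * coords b X * T := by
  have h' : S * T = 1 := mul_eq_one_comm.1 h
  let b' := b.map (Matrix.toLinOfInv b b h h')
  have hT : b.toMatrix b' = T := by
    ext i j
    simp [b', Module.Basis.toMatrix_apply, Matrix.toLinOfInv, Matrix.toLin_self,
      Finsupp.single_apply]
  have hS : b'.toMatrix b = S := by
    have := b'.toMatrix_mul_toMatrix_flip b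
    rw [hT] at this
    calc b'.toMatrix b = b'.toMatrix b * (T * S) := by rw [h, mul_one]
      _ = S := by rw [← mul_assoc, this, one_mul]
  refine ⟨b', hT, hS, fun X => ?_⟩
  rw [mul_assoc, ← hT, ← toMatrix_mul_coords, ← mul_assoc, hT, h', one_mul]

end Coordinates

/-! ### Lattices and their endomorphism rings. -/

section Lattices

variable {O K : Type*} [CommRing O] [Field K] [Algebra O K] {d : ℕ}

/-- The lattice spanned by a basis. -/
def spanLatt (O : Type*) [CommRing O] [Algebra O K] (b : Module.Basis (Fin d) K (Fin d → K)) :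
    Latt O K d :=
  ⟨Submodule.span O (Set.range b), ⟨Submodule.fg_span (Set.finite_range b), by
    rw [Submodule.span_span_of_tower, b.span_eq]⟩⟩

theorem mem_endOrder {L : Latt O K d} {X : Matrix (Fin d) (Fin d) K} :
    X ∈ endOrder L ↔ ∀ v ∈ L.1, X.mulVec v ∈ L.1 := Iff.rfl

theorem endOrder_eq_of_cls_eq {L L' : Latt O K d} (h : L.cls = L'.cls) :
    endOrder L = endOrder L' := by
  obtain ⟨c, hc, e⟩ : ∃ c : K, c ≠ 0 ∧ L'.1 = c • L.1 := Quotient.exact h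
  ext X
  rw [mem_endOrder, mem_endOrder, e]
  constructor
  · rintro h v hv
    obtain ⟨w, hw, rfl⟩ := (Submodule.mem_smul_pointwise_iff_exists _ _ _).1 hv
    rw [Matrix.mulVec_smul]
    exact Submodule.smul_mem_pointwise_smul _ _ _ (h w hw)
  · rintro h v hv
    have := h _ (Submodule.smul_mem_pointwise_smul _ c _ hv)
    rw [Matrix.mulVec_smul] at this
    obtain ⟨w, hw, e'⟩ := (Submodule.mem_smul_pointwise_iff_exists _ _ _).1 this
    rwa [← smul_right_injective _ hc e']

theorem cls_mem_Q {Λ : Subalgebra O (Matrix (Fin d) (Fin d) K)} {L : Latt O K d} :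
    L.cls ∈ Q Λ ↔ Λ ≤ endOrder L := by
  constructor
  · rintro ⟨L', h, h'⟩
    rw [← endOrder_eq_of_cls_eq h]
    exact h'
  · intro h
    exact ⟨L, rfl, h⟩

theorem mem_PZ {S : Set (Vertex O K d)} {X : Matrix (Fin d) (Fin d) K} :
    X ∈ PZ S ↔ ∀ L : Latt O K d, L.cls ∈ S → X ∈ endOrder L := by
  simp [PZ, Algebra.mem_iInf]

theorem mem_spanLatt [IsDomain O] [IsFractionRing O K] {b : Module.Basis (Fin d) K (Fin d → K)}
    {v : Fin d → K} :
    v ∈ (spanLatt O b).1 ↔ ∀ i, b.repr v i ∈ (algebraMap O K).range :=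
  b.mem_span_iff_repr_mem O v

theorem mem_endOrder_spanLatt [IsDomain O] [IsFractionRing O K]
    {b : Module.Basis (Fin d) K (Fin d → K)} {X : Matrix (Fin d) (Fin d) K} :
    X ∈ endOrder (spanLatt O b) ↔ ∀ i j, coords b X i j ∈ (algebraMap O K).range := by
  have key : ∀ i j, coords b X i j = b.repr (X.mulVec (b j)) i := fun i j => by
    rw [coords, LinearMap.toMatrix_apply, Matrix.toLin'_apply]
  rw [mem_endOrder]
  constructor
  · intro h i j
    rw [key]
    exact mem_spanLatt.1 (h (b j) (Submodule.subset_span ⟨j, rfl⟩)) i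
  · intro h v hv
    refine Submodule.span_induction (p := fun v _ => X.mulVec v ∈ (spanLatt O b).1)
      ?_ ?_ ?_ ?_ hv
    · rintro _ ⟨j, rfl⟩
      exact mem_spanLatt.2 fun i => key i j ▸ h i j
    · rw [Matrix.mulVec_zero]
      exact Submodule.zero_mem _
    · intro v w _ _ hv hw
      rw [Matrix.mulVec_add]
      exact Submodule.add_mem _ hv hw
    · intro a v _ hv
      rw [Matrix.mulVec_smul]
      exact Submodule.smul_mem _ a hv

theorem spanLatt_le_spanLatt [IsDomain O] [IsFractionRing O K]
    {b b' : Module.Basis (Fin d) K (Fin d → K)}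
    (h : ∀ i j, b.toMatrix b' i j ∈ (algebraMap O K).range) :
    (spanLatt O b').1 ≤ (spanLatt O b).1 := by
  refine Submodule.span_le.2 ?_
  rintro _ ⟨j, rfl⟩
  exact mem_spanLatt.2 fun i => h i j

/-- Over a principal ideal domain a lattice is free of rank `d`, and an `O`-basis of it is a
`K`-basis of the space. Every lattice can thus be handled through matrices. -/
theorem exists_spanLatt_eq [IsDomain O] [IsPrincipalIdealRing O] [IsFractionRing O K]
    (L : Latt O K d) : ∃ b : Module.Basis (Fin d) K (Fin d → K), spanLatt O b = L := by
  have : Submodule.IsLattice K L.1 := L.2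
  have : Module.Free O L.1 := Submodule.IsLattice.free K L.1
  let c : Module.Basis (Fin d) O L.1 :=
    Module.finBasisOfFinrankEq O L.1 (by simpa using Submodule.IsLattice.finrank_of_pi K L.1)
  refine ⟨c.extendOfIsLattice K, Subtype.ext ?_⟩
  have e : ⇑(c.extendOfIsLattice K) = L.1.subtype ∘ c :=
    funext fun i => c.extendOfIsLattice_apply K i
  change Submodule.span O (Set.range _) = L.1
  rw [e, Set.range_comp, Submodule.span_image, c.span_eq, Submodule.map_top,
    Submodule.range_subtype]

/-- Every vector in the `K`-span of an `O`-submodule has a nonzero multiple in the submodule. -/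
theorem exists_smul_mem_of_mem_span [IsDomain O] [IsFractionRing O K] {V : Type*} [AddCommGroup V]
    [Module K V] [Module O V] [IsScalarTower O K V] {M : Submodule O V} {v : V}
    (hv : v ∈ Submodule.span K (M : Set V)) : ∃ a : O, a ≠ 0 ∧ a • v ∈ M := by
  refine Submodule.span_induction (p := fun v _ => ∃ a : O, a ≠ 0 ∧ a • v ∈ M)
    ?_ ?_ ?_ ?_ hv
  · exact fun v hv => ⟨1, one_ne_zero, by simpa using hv⟩
  · exact ⟨1, one_ne_zero, by simp⟩
  · rintro v w _ _ ⟨a, ha, hv⟩ ⟨c, hc, hw⟩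
    refine ⟨a * c, mul_ne_zero ha hc, ?_⟩
    rw [smul_add]
    refine M.add_mem ?_ ?_
    · rw [mul_comm, mul_smul]
      exact M.smul_mem _ hv
    · rw [mul_smul]
      exact M.smul_mem _ hw
  · rintro x v _ ⟨a, ha, hv⟩
    obtain ⟨n, m, hm, rfl⟩ := IsFractionRing.div_surjective (A := O) x
    have hm0 : algebraMap O K m ≠ 0 := by simpa using hm
    refine ⟨m * a, mul_ne_zero (by simpa using hm) ha, ?_⟩
    have : (m * a) • (algebraMap O K n / algebraMap O K m) • v = n • a • v := by
      rw [← algebraMap_smul K (m * a), ← algebraMap_smul K n, ← algebraMap_smul K a, smul_smul,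
        smul_smul, map_mul]
      congr 1
      field_simp
    rw [this]
    exact M.smul_mem _ hv

/-- A product of denominators for the finitely many generators is a common denominator. This is what
makes any two lattices commensurable. -/
theorem exists_smul_le_of_fg [IsDomain O] [IsFractionRing O K] {V : Type*} [AddCommGroup V]
    [Module K V] [Module O V] [IsScalarTower O K V] {M N : Submodule O V} (hN : N.FG)
    (hM : Submodule.span K (M : Set V) = ⊤) : ∃ a : O, a ≠ 0 ∧ a • N ≤ M := by
  obtain ⟨s, rfl⟩ := hN
  choose f hf hfM using fun v : V =>
    exists_smul_mem_of_mem_span (K := K) (M := M) (v := v) (hM ▸ trivial)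
  refine ⟨∏ v ∈ s, f v, Finset.prod_ne_zero_iff.2 fun v _ => hf v, ?_⟩
  rw [Submodule.smul_span, Submodule.span_le]
  rintro _ ⟨v, hv, rfl⟩
  obtain ⟨c, hc⟩ := Finset.dvd_prod_of_mem f hv
  simp only [hc, mul_comm _ c, mul_smul]
  exact M.smul_mem _ (hfM v)

end Lattices

/-! ### The distance between lattice classes. -/

section Distance

variable {O K : Type*} [CommRing O] [Field K] [Algebra O K] {d : ℕ} {π : O}

theorem vdist_le {L L' : Latt O K d} {s : ℕ} (h : π ^ s • L.1 ≤ L'.1) (h' : L'.1 ≤ L.1) :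
    vdist π L.cls L'.cls ≤ s :=
  Nat.sInf_le ⟨L, L', rfl, rfl, h, h'⟩

variable [IsDomain O] [IsFractionRing O K]

/-- The distance is attained: any two classes have nested representatives. -/
theorem exists_le_of_vdist_le [IsDiscreteValuationRing O] (hπ : Irreducible π)
    {x y : Vertex O K d} {r : ℕ} (h : vdist π x y ≤ r) :
    ∃ L L' : Latt O K d, L.cls = x ∧ L'.cls = y ∧ π ^ r • L.1 ≤ L'.1 ∧ L'.1 ≤ L.1 := by
  -- The infimum of the empty set is `0` in `ℕ`, so a bound on `vdist` yields lattices only once the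
  -- set is known to be nonempty.
  have hne : {s : ℕ | ∃ L L' : Latt O K d,
      L.cls = x ∧ L'.cls = y ∧ π ^ s • L.1 ≤ L'.1 ∧ L'.1 ≤ L.1}.Nonempty := by
    obtain ⟨L, rfl⟩ := Quotient.exists_rep x
    obtain ⟨L', rfl⟩ := Quotient.exists_rep y
    obtain ⟨a, ha, hle⟩ := exists_smul_le_of_fg (K := K) L'.2.fg L.2.span_eq_top
    have ha' : algebraMap O K a ≠ 0 := by simpa using ha
    have : Submodule.IsLattice K L'.1 := L'.2
    let L'' : Latt O K d := ⟨algebraMap O K a • L'.1,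
      Submodule.IsLattice.smul K L'.1 (Units.mk0 _ ha')⟩
    have e : L''.1 = a • L'.1 := by
      ext v
      simp [L'', Submodule.mem_smul_pointwise_iff_exists]
    obtain ⟨c, hc, hle'⟩ := exists_smul_le_of_fg (K := K) L.2.fg L''.2.span_eq_top
    obtain ⟨s, u, rfl⟩ := IsDiscreteValuationRing.eq_unit_mul_pow_irreducible hc hπ
    refine ⟨s, L, L'', rfl, (Quotient.sound ⟨_, ha', rfl⟩ : L'.cls = L''.cls).symm, ?_, e ▸ hle⟩
    rintro _ ⟨v, hv, rfl⟩
    have := L''.1.smul_mem (↑u⁻¹ : O) (hle' (Submodule.smul_mem_pointwise_smul _ _ _ hv))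
    rw [smul_smul, ← mul_assoc, Units.inv_mul, one_mul] at this
    exact this
  obtain ⟨L, L', hL, hL', h1, h2⟩ := Nat.sInf_mem hne
  refine ⟨L, L', hL, hL', le_trans ?_ h1, h2⟩
  rintro _ ⟨v, hv, rfl⟩
  obtain ⟨t, ht⟩ := Nat.exists_eq_add_of_le h
  change π ^ r • v ∈ _
  rw [ht, pow_add, mul_smul]
  exact Submodule.smul_mem_pointwise_smul _ _ _ (L.1.smul_mem _ hv)

theorem vdist_spanLatt_le {b b' : Module.Basis (Fin d) K (Fin d → K)} {s : ℕ}
    (h : ∀ i j, b.toMatrix b' i j ∈ (algebraMap O K).range)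
    (h' : ∀ i j, algebraMap O K π ^ s * b'.toMatrix b i j ∈ (algebraMap O K).range) :
    vdist π (spanLatt O b).cls (spanLatt O b').cls ≤ s := by
  refine vdist_le ?_ (spanLatt_le_spanLatt h)
  change π ^ s • Submodule.span O (Set.range b) ≤ _
  rw [Submodule.smul_span, Submodule.span_le]
  rintro _ ⟨_, ⟨j, rfl⟩, rfl⟩
  refine mem_spanLatt.2 fun i => ?_
  have : π ^ s • b j = (algebraMap O K π ^ s) • b j := by rw [← map_pow, algebraMap_smul]
  simpa [this, Module.Basis.toMatrix_apply] using h' i j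

end Distance

/-! ### Bolytrope orders around a path, entry by entry. -/

section BolytropeOrder

variable {O K : Type*} [CommRing O] [IsDomain O] [Field K] [Algebra O K] [IsFractionRing O K]
  {π : O}

theorem mul_inv_pow_mem_mPow_iff (hπ : Irreducible π) {r : ℕ} {n : ℤ} {x : K} :
    x * (algebraMap O K π ^ r)⁻¹ ∈ mPow K π n ↔ x ∈ mPow K π (n + r) := by
  rw [← zpow_natCast, ← zpow_neg, mul_comm, zpow_mul_mem_mPow_iff hπ, sub_neg_eq_add]

theorem mem_graduatedOrder_upperExponent (hπ : Irreducible π)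
    {b : Module.Basis (Fin 2) K (Fin 2 → K)} {m : ℕ} {X : Matrix (Fin 2) (Fin 2) K} :
    X ∈ graduatedOrder hπ b (upperExponent m) ↔
      coords b X 0 0 ∈ mPow K π 0 ∧ coords b X 0 1 ∈ mPow K π m ∧
        coords b X 1 0 ∈ mPow K π 0 ∧ coords b X 1 1 ∈ mPow K π 0 := by
  change (∀ i j, coords b X i j ∈ mPow K π ((upperExponent m).1 i j)) ↔ _
  simp [Fin.forall_fin_two, upperExponent, and_assoc]

/-- The entrywise description of the bolytrope order of radius `r` around a path of length `m`. -/
theorem mem_bolytropeOrder_upperExponent [IsDiscreteValuationRing O] (hπ : Irreducible π)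
    {b : Module.Basis (Fin 2) K (Fin 2 → K)} {r m : ℕ} {X : Matrix (Fin 2) (Fin 2) K} :
    X ∈ bolytropeOrder hπ b r (upperExponent m) ↔
      (∀ i j, coords b X i j ∈ (algebraMap O K).range) ∧
        coords b X 0 1 ∈ mPow K π ((m : ℤ) + r) ∧ coords b X 1 0 ∈ mPow K π (r : ℤ) ∧
        coords b X 0 0 - coords b X 1 1 ∈ mPow K π (r : ℤ) := by
  have h0 : algebraMap O K π ≠ 0 := irreducible_map_ne_zero hπ
  rw [bolytropeOrder, mem_PZ]
  constructor
  · intro h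
    -- `c` spans a lattice of the center and `g` a larger one at distance at most `r`. Three choices
    -- of the pair suffice to extract all the conditions.
    have key : ∀ {c g : Module.Basis (Fin 2) K (Fin 2 → K)},
        graduatedOrder hπ b (upperExponent m) ≤ endOrder (spanLatt O c) →
        (∀ i j, g.toMatrix c i j ∈ mPow K π 0) →
        (∀ i j, algebraMap O K π ^ r * c.toMatrix g i j ∈ mPow K π 0) →
        ∀ i j, coords g X i j ∈ mPow K π 0 := by
      intro c g hc h1 h2
      simp only [mem_mPow_zero] at h1 h2 ⊢
      exact mem_endOrder_spanLatt.1 (h _ ⟨_, cls_mem_Q.2 hc, vdist_spanLatt_le h1 h2⟩)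
    have one : (1 : K) ∈ mPow K π 0 := one_mem_mPow_zero
    have pow : ∀ n : ℕ, algebraMap O K π ^ n ∈ mPow K π 0 := fun n =>
      mem_mPow_zero.2 ⟨π ^ n, map_pow _ _ _⟩
    have start : graduatedOrder hπ b (upperExponent m) ≤ endOrder (spanLatt O b) := by
      intro Y hY
      rw [mem_graduatedOrder_upperExponent] at hY
      rw [mem_endOrder_spanLatt]
      simp only [← mem_mPow_zero (π := π), Fin.forall_fin_two]
      exact ⟨⟨hY.1, mPow_antitone hπ (by lia) hY.2.1⟩, hY.2.2⟩
    -- the lattice beyond the first end of the path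
    obtain ⟨g, hg, hg', hgX⟩ := exists_basis_toMatrix_eq b
      (T := !![(algebraMap O K π ^ r)⁻¹, 0; 0, 1]) (S := !![algebraMap O K π ^ r, 0; 0, 1])
      (by simp [Matrix.one_fin_two, h0])
    have H1 := key (c := b) (g := g) start
      (by simp [hg', Fin.forall_fin_two, one, pow])
      (by simp [hg, Fin.forall_fin_two, one, pow, h0])
    -- the lattice beyond the other end
    obtain ⟨c, hc, hc', hcX⟩ := exists_basis_toMatrix_eq b
      (T := !![algebraMap O K π ^ m, 0; 0, 1]) (S := !![(algebraMap O K π ^ m)⁻¹, 0; 0, 1])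
      (by simp [Matrix.one_fin_two, h0])
    have finish : graduatedOrder hπ b (upperExponent m) ≤ endOrder (spanLatt O c) := by
      intro Y hY
      rw [mem_graduatedOrder_upperExponent] at hY
      rw [mem_endOrder_spanLatt]
      simp only [← mem_mPow_zero (π := π), Fin.forall_fin_two, hcX]
      have e00 : (algebraMap O K π ^ m)⁻¹ * coords b Y 0 0 * algebraMap O K π ^ m
          = coords b Y 0 0 := by field_simp
      have h01 : (algebraMap O K π ^ m)⁻¹ * coords b Y 0 1 ∈ mPow K π 0 := by
        rw [mul_comm, mul_inv_pow_mem_mPow_iff hπ, zero_add]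
        exact hY.2.1
      have h10 : coords b Y 1 0 * algebraMap O K π ^ m ∈ mPow K π 0 :=
        mPow_mul_mem h0 (by simp) hY.2.2.1 (pow m)
      simp only [Matrix.mul_apply, Fin.sum_univ_two]
      simpa [e00] using ⟨⟨hY.1, h01⟩, h10, hY.2.2.2⟩
    obtain ⟨e, he, he', heX⟩ := exists_basis_toMatrix_eq c
      (T := !![1, 0; 0, (algebraMap O K π ^ r)⁻¹]) (S := !![1, 0; 0, algebraMap O K π ^ r])
      (by simp [Matrix.one_fin_two, h0])
    have H2 := key (c := c) (g := e) finish
      (by simp [he', Fin.forall_fin_two, one, pow])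
      (by simp [he, Fin.forall_fin_two, one, pow, h0])
    -- a lattice off the apartment of the path
    obtain ⟨f, hf, hf', hfX⟩ := exists_basis_toMatrix_eq b
      (T := !![(algebraMap O K π ^ r)⁻¹, 0; (algebraMap O K π ^ r)⁻¹, 1])
      (S := !![algebraMap O K π ^ r, 0; -1, 1])
      (by simp [Matrix.one_fin_two, h0])
    have H3 := key (c := b) (g := f) start
      (by simp [hf', Fin.forall_fin_two, one, pow])
      (by simp [hf, Fin.forall_fin_two, one, pow, h0])
    simp only [hgX, Fin.forall_fin_two, Matrix.mul_apply, Fin.sum_univ_two] at H1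
    simp only [heX, hcX, Fin.forall_fin_two, Matrix.mul_apply, Fin.sum_univ_two] at H2
    simp only [hfX, Fin.forall_fin_two, Matrix.mul_apply, Fin.sum_univ_two] at H3
    simp only [Matrix.of_apply, Matrix.cons_val', Matrix.cons_val_zero, Matrix.cons_val_one,
      Matrix.cons_val_fin_one, zero_mul, mul_zero, mul_one, one_mul, zero_add, add_zero, neg_mul]
      at H1 H2 H3
    have h10 : coords b X 1 0 ∈ mPow K π r := by
      simpa [mul_inv_pow_mem_mPow_iff hπ] using H1.2.1
    have h01 : coords b X 0 1 ∈ mPow K π (m + r) := by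
      have := H2.1.2
      rw [mul_inv_pow_mem_mPow_iff hπ, mul_comm, mul_inv_pow_mem_mPow_iff hπ] at this
      simpa [add_comm] using this
    have h00 : coords b X 0 0 ∈ mPow K π 0 := by
      have e : (algebraMap O K π ^ m)⁻¹ * coords b X 0 0 * algebraMap O K π ^ m
          = coords b X 0 0 := by field_simp
      exact e ▸ H2.1.1
    -- The lower left entry for `f` puts `X₂₁ - X₁₂ - (X₁₁ - X₂₂)` in `𝔪 ^ r`, and the off-diagonal
    -- entries are already known to lie there.
    have hd : coords b X 0 0 - coords b X 1 1 ∈ mPow K π r := by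
      have := H3.2.1
      rw [← add_mul, mul_inv_pow_mem_mPow_iff hπ, zero_add] at this
      have := (mPow K π (r : ℤ)).sub_mem
        ((mPow K π (r : ℤ)).sub_mem h10 (mPow_antitone hπ (by lia) h01)) this
      convert this using 1
      ring
    refine ⟨?_, h01, h10, hd⟩
    simp only [← mem_mPow_zero (π := π), Fin.forall_fin_two]
    exact ⟨⟨h00, mPow_antitone hπ (by lia) h01⟩, mPow_antitone hπ (by lia) h10, H1.2.2⟩
  · rintro ⟨hi, h01, h10, hd⟩ L ⟨y, hy, hr⟩
    simp only [← mem_mPow_zero (π := π), Fin.forall_fin_two] at hi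
    obtain ⟨L₁, L', hL₁, rfl, hle, hle'⟩ := exists_le_of_vdist_le hπ hr
    rw [← endOrder_eq_of_cls_eq hL₁]
    have hL' := cls_mem_Q.1 hy
    obtain ⟨a, ha⟩ := mem_mPow_zero.1 hi.2.2
    -- Write `X = a + π ^ r Y` with `a = X₂₂`. Then `Y₂₂ = 0`, the congruence says that `Y₁₁` is
    -- integral, and `Y` lies in the graduated order. Hence `π ^ r Y L₁ ⊆ Y L' ⊆ L' ⊆ L₁` for each
    -- `L₁` within distance `r` of a stable `L'`.
    set Y := (algebraMap O K π ^ r)⁻¹ • (X - algebraMap O _ a) with hY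
    have eX : X = algebraMap O _ a + algebraMap O K π ^ r • Y := by
      rw [hY, smul_smul, mul_inv_cancel₀ (pow_ne_zero _ h0), one_smul, add_sub_cancel]
    have hYmem : Y ∈ graduatedOrder hπ b (upperExponent m) := by
      have hc : coords b X = algebraMap O _ a + algebraMap O K π ^ r • coords b Y := by
        conv_lhs => rw [eX]
        rw [coords_add, coords_algebraMap]
        simp [coords]
      rw [hc] at h01 h10 hd ha
      rw [mem_graduatedOrder_upperExponent]
      simp only [Matrix.add_apply, Matrix.smul_apply, Matrix.algebraMap_matrix_apply, if_true,
        zero_ne_one, one_ne_zero, if_false, zero_add, smul_eq_mul, ← zpow_natCast,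
        zpow_mul_mem_mPow_iff hπ, add_sub_cancel_right, sub_self, add_sub_add_left_eq_sub,
        ← mul_sub] at h01 h10 hd ha
      have h11 : coords b Y 1 1 = 0 := by
        simpa [hπ.ne_zero] using ha
      rw [h11, sub_zero] at hd
      exact ⟨hd, h01, h10, h11 ▸ Submodule.zero_mem _⟩
    rw [eX]
    refine Subalgebra.add_mem _ (Subalgebra.algebraMap_mem _ a) fun v hv => ?_
    refine hle' ?_
    rw [Matrix.smul_mulVec, ← Matrix.mulVec_smul, ← map_pow, algebraMap_smul]
    exact hL' hYmem _ (hle (Submodule.smul_mem_pointwise_smul _ _ _ hv))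

end BolytropeOrder

/-! ### Normal forms of lattices in the plane. -/

section NormalForm

variable {O K : Type*} [CommRing O] [Field K] [Algebra O K] {π : O}

/-- With respect to a basis `(e₁, e₂)`, the matrix `x` maps the lattice spanned by `e₁ + t e₂` and
`π ^ c e₂` to itself. -/
def StabilizesNormal (π : O) (t : K) (c : ℤ) (x : Matrix (Fin 2) (Fin 2) K) : Prop :=
  x 0 0 + t * x 0 1 ∈ mPow K π 0 ∧ x 0 1 ∈ mPow K π (-c) ∧
    x 1 0 + t * (x 1 1 - x 0 0) - t ^ 2 * x 0 1 ∈ mPow K π c ∧ x 1 1 - t * x 0 1 ∈ mPow K π 0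

variable [IsDomain O] [IsFractionRing O K]

/-- The four conditions are integrality of the entries of the conjugate of `x` by the matrix with
columns `e₁ + t e₂` and `π ^ c e₂`, with the powers of `π` moved to the other side. -/
theorem stabilizesNormal_iff_forall_mem (hπ : Irreducible π) {t : K} {c : ℤ}
    {x : Matrix (Fin 2) (Fin 2) K} : StabilizesNormal π t c x ↔ ∀ i j,
      (!![1, 0; -(t * algebraMap O K π ^ (-c)), algebraMap O K π ^ (-c)] * x *
        !![1, 0; t, algebraMap O K π ^ c]) i j ∈ mPow K π 0 := by
  have h0 : algebraMap O K π ≠ 0 := irreducible_map_ne_zero hπ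
  have hc : algebraMap O K π ^ (-c) * algebraMap O K π ^ c = 1 := by
    rw [← zpow_add₀ h0, neg_add_cancel, zpow_zero]
  have e1 : x 0 1 ∈ mPow K π (-c) ↔ x 0 1 * algebraMap O K π ^ c ∈ mPow K π 0 := by
    rw [mul_comm, zpow_mul_mem_mPow_iff hπ, zero_sub]
  have e2 : x 1 0 + t * (x 1 1 - x 0 0) - t ^ 2 * x 0 1 ∈ mPow K π c ↔
      algebraMap O K π ^ (-c) * (x 1 0 + t * (x 1 1 - x 0 0) - t ^ 2 * x 0 1) ∈ mPow K π 0 := by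
    rw [zpow_mul_mem_mPow_iff hπ, zero_sub, neg_neg]
  rw [StabilizesNormal, e1, e2]
  simp only [Fin.forall_fin_two, Matrix.mul_apply, Fin.sum_univ_two, Matrix.of_apply,
    Matrix.cons_val', Matrix.cons_val_zero, Matrix.cons_val_one, Matrix.cons_val_fin_one]
  rw [and_assoc]
  refine and_congr (by ring_nf) (and_congr (by ring_nf) (and_congr ?_ ?_))
  · ring_nf
  · have : (-(t * algebraMap O K π ^ (-c)) * x 0 0 + algebraMap O K π ^ (-c) * x 1 0) * 0 +
        (-(t * algebraMap O K π ^ (-c)) * x 0 1 + algebraMap O K π ^ (-c) * x 1 1) *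
          algebraMap O K π ^ c = x 1 1 - t * x 0 1 := by
      linear_combination (x 1 1 - t * x 0 1) * hc
    rw [this]

theorem mul_integral {d : ℕ} {x y : Matrix (Fin d) (Fin d) K}
    (hπ : Irreducible π) (hx : ∀ i j, x i j ∈ mPow K π 0) (hy : ∀ i j, y i j ∈ mPow K π 0) (i j) :
    (x * y) i j ∈ mPow K π 0 := by
  rw [Matrix.mul_apply]
  exact Submodule.sum_mem _ fun k _ =>
    mPow_mul_mem (irreducible_map_ne_zero hπ) (by simp) (hx i k) (hy k j)

/-- Column reduction of an invertible matrix over the valuation ring. -/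
theorem exists_eq_normal_mul [IsDiscreteValuationRing O] (hπ : Irreducible π)
    {T : Matrix (Fin 2) (Fin 2) K} (hT : T.det ≠ 0) :
    ∃ (a t : K) (c : ℤ) (U V : Matrix (Fin 2) (Fin 2) K), a ≠ 0 ∧ U * V = 1 ∧
      (∀ i j, U i j ∈ mPow K π 0) ∧ (∀ i j, V i j ∈ mPow K π 0) ∧
      T = a • (!![1, 0; t, algebraMap O K π ^ c] * U) := by
  have h0 : algebraMap O K π ≠ 0 := irreducible_map_ne_zero hπ
  rw [Matrix.det_fin_two] at hT
  have one : (1 : K) ∈ mPow K π 0 := one_mem_mPow_zero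
  -- The pivot `a` is an entry of the first row that divides the other one in `O`. Comparing
  -- determinants then forces `π ^ c` to be `det T / a ^ 2` up to a unit.
  by_cases h : T 0 0 ≠ 0 ∧ T 0 1 / T 0 0 ∈ mPow K π 0
  · obtain ⟨h00, hq⟩ := h
    obtain ⟨c, -, -, w, hw, hw', hw0, e⟩ := exists_mem_mPow_inv_mem hπ
      (x := (T 0 0 * T 1 1 - T 0 1 * T 1 0) / T 0 0 ^ 2) (by positivity)
    refine ⟨T 0 0, T 1 0 / T 0 0, c, !![1, T 0 1 / T 0 0; 0, w],
      !![1, -(T 0 1 / T 0 0 * w⁻¹); 0, w⁻¹], h00, ?_, ?_, ?_, ?_⟩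
    · simp [Matrix.one_fin_two, hw0]
    · simp [Fin.forall_fin_two, one, hq, hw]
    · simpa [Fin.forall_fin_two, one, hw'] using mPow_mul_mem h0 (by simp) hq hw'
    · rw [Matrix.mul_fin_two, one_mul, zero_mul, add_zero]
      have : T 1 1 = T 0 0 * (T 1 0 / T 0 0 * (T 0 1 / T 0 0) + algebraMap O K π ^ c * w) := by
        rw [← e]
        field_simp
        ring
      ext i j
      fin_cases i <;> fin_cases j
      · simp
      · simp; field_simp
      · simp; field_simp
      · simpa using this
  · have h01 : T 0 1 ≠ 0 := by
      intro h01
      refine h ⟨?_, by simp [h01]⟩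
      rintro h00
      simp [h00, h01] at hT
    have hq : T 0 0 / T 0 1 ∈ mPow K π 0 := by
      by_cases h00 : T 0 0 = 0
      · simp [h00]
      obtain ⟨k, hk, hk', -⟩ := exists_mem_mPow_inv_mem hπ (div_ne_zero h01 h00)
      have : ¬ 0 ≤ k := fun h' => h ⟨h00, mPow_antitone hπ h' hk⟩
      rw [← inv_div]
      exact mPow_antitone hπ (by lia) hk'
    obtain ⟨c, -, -, w, hw, hw', hw0, e⟩ := exists_mem_mPow_inv_mem hπ
      (x := -(T 0 0 * T 1 1 - T 0 1 * T 1 0) / T 0 1 ^ 2) (div_ne_zero (neg_ne_zero.2 hT) (pow_ne_zero 2 h01))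
    refine ⟨T 0 1, T 1 1 / T 0 1, c, !![T 0 0 / T 0 1, 1; w, 0],
      !![0, w⁻¹; 1, -(T 0 0 / T 0 1 * w⁻¹)], h01, ?_, ?_, ?_, ?_⟩
    · simp [Matrix.one_fin_two, hw0]
    · simp [Fin.forall_fin_two, one, hq, hw]
    · simpa [Fin.forall_fin_two, one, hw'] using mPow_mul_mem h0 (by simp) hq hw'
    · rw [Matrix.mul_fin_two, one_mul, zero_mul, add_zero]
      have : T 1 0 = T 0 1 * (T 1 1 / T 0 1 * (T 0 0 / T 0 1) + algebraMap O K π ^ c * w) := by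
        rw [← e]
        field_simp
        ring
      ext i j
      fin_cases i <;> fin_cases j
      · simp; field_simp
      · simp
      · simpa using this
      · simp; field_simp

/-- Up to homothety every lattice is spanned by `e₁ + t e₂` and `π ^ c e₂` for some `t` and `c`. -/
theorem exists_stabilizesNormal_iff [IsDiscreteValuationRing O] (hπ : Irreducible π)
    (b b' : Module.Basis (Fin 2) K (Fin 2 → K)) :
    ∃ (t : K) (c : ℤ), ∀ X, X ∈ endOrder (spanLatt O b') ↔ StabilizesNormal π t c (coords b X) := by
  have h0 : algebraMap O K π ≠ 0 := irreducible_map_ne_zero hπ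
  have hdet : (b.toMatrix b').det ≠ 0 := by
    intro h
    have := congrArg Matrix.det (b.toMatrix_mul_toMatrix_flip b')
    rw [Matrix.det_mul, h, zero_mul, Matrix.det_one] at this
    exact zero_ne_one this
  obtain ⟨a, t, c, U, V, ha, hUV, hU, hV, hT⟩ := exists_eq_normal_mul hπ hdet
  refine ⟨t, c, fun X => ?_⟩
  rw [mem_endOrder_spanLatt, stabilizesNormal_iff_forall_mem hπ]
  simp only [← mem_mPow_zero (π := π)]
  set N : Matrix (Fin 2) (Fin 2) K := !![1, 0; t, algebraMap O K π ^ c]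
  set N' : Matrix (Fin 2) (Fin 2) K :=
    !![1, 0; -(t * algebraMap O K π ^ (-c)), algebraMap O K π ^ (-c)]
  have hN : N' * N = 1 := by
    have hc : algebraMap O K π ^ (-c) * algebraMap O K π ^ c = 1 := by
      rw [← zpow_add₀ h0, neg_add_cancel, zpow_zero]
    rw [Matrix.mul_fin_two, Matrix.one_fin_two, hc]
    congr! <;> ring
  have e := toMatrix_mul_coords b b' X
  rw [hT, smul_mul_assoc, mul_smul_comm] at e
  replace e := smul_right_injective _ ha e
  have hVU : V * U = 1 := mul_eq_one_comm.1 hUV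
  -- The scalar `a` cancels in the conjugation, and conjugation by `U`, which is invertible over
  -- `O`, preserves integrality.
  have e' : N' * coords b X * N = U * coords b' X * V := by
    calc N' * coords b X * N = N' * (coords b X * (N * U)) * V := by
          simp only [mul_assoc, hUV, mul_one]
      _ = N' * N * U * coords b' X * V := by rw [← e]; simp only [mul_assoc]
      _ = U * coords b' X * V := by rw [hN, one_mul]
  have e'' : coords b' X = V * (N' * coords b X * N) * U := by
    rw [e', ← mul_assoc, ← mul_assoc, hVU, one_mul, mul_assoc, hVU, mul_one]
  constructor
  · intro h
    rw [e']
    exact mul_integral hπ (mul_integral hπ hU h) hV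
  · intro h
    rw [e'']
    exact mul_integral hπ (mul_integral hπ hV h) hU

end NormalForm

/-! ### Longest stable paths and the shape of a closed order. -/

section ClosedOrders

variable {O K : Type*} [CommRing O] [Field K] [Algebra O K] {π : O}

/-- An order stabilizes some lattice. -/
theorem IsOrder.exists_le_endOrder {d : ℕ} [NeZero d]
    {Λ : Subalgebra O (Matrix (Fin d) (Fin d) K)}
    (hΛ : IsOrder Λ) : ∃ L : Latt O K d, Λ ≤ endOrder L := by
  -- The stable lattice is `Λ v` for the first standard basis vector `v`.
  let f : Matrix (Fin d) (Fin d) K →ₗ[K] (Fin d → K) :=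
    (Matrix.mulVecBilin K K).flip (Pi.single 0 1)
  have hf : Function.Surjective f := by
    intro v
    refine ⟨Matrix.of fun i _ => v i, ?_⟩
    ext i
    simp [f]
  refine ⟨⟨(Subalgebra.toSubmodule Λ).map (f.restrictScalars O), hΛ.fg.map _, ?_⟩, ?_⟩
  · rw [Submodule.map_coe, LinearMap.coe_restrictScalars, Submodule.span_image, hΛ.span_eq_top,
      Submodule.map_top, LinearMap.range_eq_top.2 hf]
  · rintro X hX _ ⟨Y, hY, rfl⟩
    refine ⟨X * Y, Λ.mul_mem hX hY, ?_⟩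
    simp [f]

/-- The matrices of the members of `Λ` with respect to `b` are upper triangular modulo `π ^ E`. -/
def IsUpperTriangularMod (π : O) (Λ : Subalgebra O (Matrix (Fin 2) (Fin 2) K))
    (b : Module.Basis (Fin 2) K (Fin 2 → K)) (E : ℤ) : Prop :=
  ∀ X ∈ Λ, coords b X 0 0 ∈ mPow K π 0 ∧ coords b X 0 1 ∈ mPow K π 0 ∧
    coords b X 1 0 ∈ mPow K π E ∧ coords b X 1 1 ∈ mPow K π 0

variable [IsDomain O] [IsFractionRing O K]

theorem IsOrder.exists_smul_mem {d : ℕ} {Λ : Subalgebra O (Matrix (Fin d) (Fin d) K)}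
    (hΛ : IsOrder Λ) (X : Matrix (Fin d) (Fin d) K) : ∃ a : O, a ≠ 0 ∧ a • X ∈ Λ :=
  exists_smul_mem_of_mem_span (K := K) (M := Subalgebra.toSubmodule Λ)
    (hΛ.span_eq_top ▸ Submodule.mem_top)

/-- The determinant of commutators bounds how far an order is from being upper triangular. -/
theorem IsOrder.exists_bound [IsDiscreteValuationRing O] (hπ : Irreducible π)
    {Λ : Subalgebra O (Matrix (Fin 2) (Fin 2) K)} (hΛ : IsOrder Λ) :
    ∃ B : ℕ, ∀ (b : Module.Basis (Fin 2) K (Fin 2 → K)) (E : ℕ),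
      IsUpperTriangularMod π Λ b E → E ≤ B := by
  have h0 : algebraMap O K π ≠ 0 := irreducible_map_ne_zero hπ
  -- Multiples of the two off-diagonal matrix units lie in `Λ`; their commutator is diagonal with
  -- nonzero determinant.
  obtain ⟨a, ha, hX⟩ := hΛ.exists_smul_mem !![0, 1; 0, 0]
  obtain ⟨c, hc, hY⟩ := hΛ.exists_smul_mem !![0, 0; 1, 0]
  set X : Matrix (Fin 2) (Fin 2) K := a • !![0, 1; 0, 0] with eX
  set Y : Matrix (Fin 2) (Fin 2) K := c • !![0, 0; 1, 0] with eY
  have hdet : (X * Y - Y * X).det ≠ 0 := by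
    have eX' : X = !![0, algebraMap O K a; 0, 0] := by
      simp [eX, Algebra.algebraMap_eq_smul_one]
    have eY' : Y = !![0, 0; algebraMap O K c, 0] := by
      simp [eY, Algebra.algebraMap_eq_smul_one]
    rw [eX', eY', Matrix.mul_fin_two, Matrix.mul_fin_two, Matrix.det_fin_two]
    simp [ha, hc]
  obtain ⟨k, -, hk, -⟩ := exists_mem_mPow_inv_mem hπ hdet
  refine ⟨k.toNat, fun b E hb => ?_⟩
  -- The commutator has diagonal `p, -p` and off-diagonal entries `q, s`, where `p, s ∈ 𝔪 ^ E` and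
  -- `q` is integral. Its determinant `-(p ^ 2 + q s)` does not depend on the basis, so its
  -- valuation bounds `E` for all bases at once.
  have hE : (X * Y - Y * X).det ∈ mPow K π E := by
    have e : coords b (X * Y - Y * X) = coords b X * coords b Y - coords b Y * coords b X := by
      rw [← coords_mul, ← coords_mul]
      simp [coords]
    rw [← det_coords b, e, Matrix.det_fin_two]
    obtain ⟨x00, x01, x10, x11⟩ := hb X hX
    obtain ⟨y00, y01, y10, y11⟩ := hb Y hY
    simp only [Matrix.sub_apply, Matrix.mul_apply, Fin.sum_univ_two]
    generalize coords b X = x at *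
    generalize coords b Y = y at *
    have mul : ∀ {n : ℤ} {u v : K}, u ∈ mPow K π 0 → v ∈ mPow K π n → u * v ∈ mPow K π n :=
      fun hu hv => mPow_mul_mem h0 (by simp) hu hv
    have p : x 0 1 * y 1 0 - y 0 1 * x 1 0 ∈ mPow K π E :=
      Submodule.sub_mem _ (mul x01 y10) (mul y01 x10)
    have p' : x 0 1 * y 1 0 - y 0 1 * x 1 0 ∈ mPow K π 0 := mPow_antitone hπ (by simp) p
    have q : (x 0 0 - x 1 1) * y 0 1 - (y 0 0 - y 1 1) * x 0 1 ∈ mPow K π 0 :=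
      Submodule.sub_mem _ (mul (Submodule.sub_mem _ x00 x11) y01)
        (mul (Submodule.sub_mem _ y00 y11) x01)
    have s : (y 0 0 - y 1 1) * x 1 0 - (x 0 0 - x 1 1) * y 1 0 ∈ mPow K π E :=
      Submodule.sub_mem _ (mul (Submodule.sub_mem _ y00 y11) x10)
        (mul (Submodule.sub_mem _ x00 x11) y10)
    convert Submodule.neg_mem _ (Submodule.add_mem _ (mul p' p) (mul q s)) using 1
    ring
  have := mPow_mul_mem h0 le_rfl hE hk
  rw [mul_inv_cancel₀ hdet] at this
  have := nonpos_of_one_mem_mPow hπ this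
  lia

/-- A stable lattice is a path of length `0`, and lengths are bounded. Maximality is stated for
integers `E`, so that it applies to differences of exponents before their sign is known. -/
theorem IsOrder.exists_maximal_isUpperTriangularMod [IsDiscreteValuationRing O]
    (hπ : Irreducible π) {Λ : Subalgebra O (Matrix (Fin 2) (Fin 2) K)} (hΛ : IsOrder Λ) :
    ∃ (b : Module.Basis (Fin 2) K (Fin 2 → K)) (D : ℕ), IsUpperTriangularMod π Λ b D ∧
      ∀ (g : Module.Basis (Fin 2) K (Fin 2 → K)) (E : ℤ),
        IsUpperTriangularMod π Λ g E → E ≤ D := by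
  classical
  obtain ⟨B, hB⟩ := hΛ.exists_bound hπ
  let P : ℕ → Prop := fun E => ∃ g, IsUpperTriangularMod π Λ g E
  have hP : P 0 := by
    obtain ⟨L, hL⟩ := hΛ.exists_le_endOrder
    obtain ⟨g, rfl⟩ := exists_spanLatt_eq L
    refine ⟨g, fun X hX => ?_⟩
    have h := mem_endOrder_spanLatt.1 (hL hX)
    simp only [← mem_mPow_zero (π := π)] at h
    exact ⟨h 0 0, h 0 1, h 1 0, h 1 1⟩
  obtain ⟨b, hb⟩ := Nat.findGreatest_spec (Nat.zero_le B) hP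
  refine ⟨b, _, hb, fun g E hg => ?_⟩
  by_cases hE : 0 ≤ E
  · lift E to ℕ using hE
    exact Int.ofNat_le.2 (Nat.le_findGreatest (P := P) (hB g E hg) ⟨g, hg⟩)
  · lia

/-- Here `t e₂` is a multiple of `π ^ c e₂`, so the lattice is `⟨e₁, π ^ c e₂⟩` and `t` may be
replaced by `0`. -/
theorem stabilizesNormal_iff_of_mem (hπ : Irreducible π) {t : K} {c : ℤ} (ht : t ∈ mPow K π c)
    {x : Matrix (Fin 2) (Fin 2) K} : StabilizesNormal π t c x ↔
      x 0 0 ∈ mPow K π 0 ∧ x 0 1 ∈ mPow K π (-c) ∧ x 1 0 ∈ mPow K π c ∧ x 1 1 ∈ mPow K π 0 := by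
  have h0 : algebraMap O K π ≠ 0 := irreducible_map_ne_zero hπ
  have aux : x 0 1 ∈ mPow K π (-c) → t * x 0 1 ∈ mPow K π 0 := fun h =>
    mPow_mul_mem h0 (by simp) ht h
  have aux' : x 0 1 ∈ mPow K π (-c) → x 0 0 ∈ mPow K π 0 → x 1 1 ∈ mPow K π 0 →
      t * (x 1 1 - x 0 0) - t ^ 2 * x 0 1 ∈ mPow K π c := fun h h00 h11 => by
    have := mPow_mul_mem h0 (n := c) (by simp) ht
      (Submodule.sub_mem _ (Submodule.sub_mem _ h11 h00) (aux h))
    convert this using 1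
    ring
  constructor
  · rintro ⟨h00, h01, h10, h11⟩
    rw [Submodule.add_mem_iff_left _ (aux h01)] at h00
    rw [Submodule.sub_mem_iff_left _ (aux h01)] at h11
    rw [add_sub_assoc, Submodule.add_mem_iff_left _ (aux' h01 h00 h11)] at h10
    exact ⟨h00, h01, h10, h11⟩
  · rintro ⟨h00, h01, h10, h11⟩
    refine ⟨Submodule.add_mem _ h00 (aux h01), h01, ?_, Submodule.sub_mem _ h11 (aux h01)⟩
    rw [add_sub_assoc]
    exact Submodule.add_mem _ h10 (aux' h01 h00 h11)

variable {Λ : Subalgebra O (Matrix (Fin 2) (Fin 2) K)} {b : Module.Basis (Fin 2) K (Fin 2 → K)}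
  {D : ℕ}

/-- A stable lattice in the apartment of a stable path of maximal length lies on the path. -/
theorem exponent_mem_Icc_of_maximal (hπ : Irreducible π) (hb : IsUpperTriangularMod π Λ b D)
    (hmax : ∀ (g : Module.Basis (Fin 2) K (Fin 2 → K)) (E : ℤ),
      IsUpperTriangularMod π Λ g E → E ≤ D)
    {t : K} {c : ℤ} (ht : t ∈ mPow K π c) (hs : ∀ X ∈ Λ, StabilizesNormal π t c (coords b X)) :
    0 ≤ c ∧ c ≤ D := by
  have h0 : algebraMap O K π ≠ 0 := irreducible_map_ne_zero hπ
  simp only [stabilizesNormal_iff_of_mem hπ ht] at hs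
  refine ⟨?_, hmax b c fun X hX => ⟨(hb X hX).1, (hb X hX).2.1, (hs X hX).2.2.1, (hb X hX).2.2.2⟩⟩
  -- The basis `(e₁, π ^ c e₂)` describes the path from exponent `c` to exponent `D`. Its length `D
  -- - c` would exceed `D` for negative `c`.
  obtain ⟨g, -, -, hg⟩ := exists_basis_toMatrix_eq b
    (T := !![1, 0; 0, algebraMap O K π ^ c]) (S := !![1, 0; 0, algebraMap O K π ^ (-c)])
    (by simp [Matrix.one_fin_two, h0, zpow_ne_zero])
  have := hmax g (D - c) fun X hX => by
    obtain ⟨h00, h01, h10, h11⟩ := hb X hX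
    simp only [hg, Matrix.mul_apply, Fin.sum_univ_two, Matrix.of_apply,
      Matrix.cons_val', Matrix.cons_val_zero, Matrix.cons_val_one, Matrix.cons_val_fin_one,
      one_mul, zero_mul, mul_zero, mul_one, add_zero, zero_add]
    refine ⟨h00, mPow_mul_mem h0 (by simp) (hs X hX).2.1 (zpow_mem_mPow c),
      mPow_mul_mem h0 (by lia) (zpow_mem_mPow (-c)) h10, ?_⟩
    rw [mul_right_comm, ← zpow_add₀ h0]
    simpa using h11
  lia

/-- A stable lattice that branches off a stable path of maximal length does so far enough from both
ends of the path. -/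
theorem exponent_bounds_of_maximal (hπ : Irreducible π) (hb : IsUpperTriangularMod π Λ b D)
    (hmax : ∀ (g : Module.Basis (Fin 2) K (Fin 2 → K)) (E : ℤ),
      IsUpperTriangularMod π Λ g E → E ≤ D)
    {t : K} {c k : ℤ} (ht0 : t ≠ 0) (ht' : t⁻¹ ∈ mPow K π (-k)) (hk : k < c)
    (hs : ∀ X ∈ Λ, StabilizesNormal π t c (coords b X)) :
    0 ≤ k ∧ c ≤ D ∧ c ≤ 2 * k := by
  have h0 : algebraMap O K π ≠ 0 := irreducible_map_ne_zero hπ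
  -- The basis `(e₁ + t e₂, π ^ (k - D) e₁)` describes the path from the end `⟨e₁, π ^ D e₂⟩`
  -- through the branch point to the given lattice, of length `(D - k) + (c - k)`.
  have far : k ≤ D → c ≤ 2 * k := by
    intro hkD
    have hq : algebraMap O K π ^ (k - D) * algebraMap O K π ^ (D - k) = 1 := by
      rw [← zpow_add₀ h0]
      simp
    obtain ⟨g, -, -, hg⟩ := exists_basis_toMatrix_eq b
      (T := !![1, algebraMap O K π ^ (k - D); t, 0])
      (S := !![0, t⁻¹; algebraMap O K π ^ (D - k), -(t⁻¹ * algebraMap O K π ^ (D - k))])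
      (by
        have e : 1 * t⁻¹ +
            algebraMap O K π ^ (k - D) * -(t⁻¹ * algebraMap O K π ^ (D - k)) = 0 := by
          linear_combination (-t⁻¹) * hq
        rw [Matrix.mul_fin_two, Matrix.one_fin_two, e, hq, mul_inv_cancel₀ ht0]
        simp)
    have := hmax g (c - k + (D - k)) fun X hX => by
      obtain ⟨h00, h01, h10, h11⟩ := hb X hX
      obtain ⟨-, -, hs10, -⟩ := hs X hX
      have hquot : t⁻¹ * coords b X 1 0 ∈ mPow K π (D - k) := mPow_mul_mem h0 (by lia) ht' h10
      have hquot' : t⁻¹ * coords b X 1 0 ∈ mPow K π 0 := mPow_antitone hπ (by lia) hquot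
      simp only [hg, Matrix.mul_apply, Fin.sum_univ_two, Matrix.of_apply,
        Matrix.cons_val', Matrix.cons_val_zero, Matrix.cons_val_one, Matrix.cons_val_fin_one]
      refine ⟨?_, ?_, ?_, ?_⟩
      · convert Submodule.add_mem _ hquot' h11 using 1
        linear_combination coords b X 1 1 * inv_mul_cancel₀ ht0
      · convert mPow_mul_mem h0 (n := 0) (by lia) hquot (zpow_mem_mPow (k - D)) using 1
        ring
      · have := mPow_mul_mem h0 (n := c - k + (D - k)) (by lia)
          (mPow_mul_mem h0 le_rfl hs10 ht') (zpow_mem_mPow (D - k))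
        convert Submodule.neg_mem _ this using 1
        linear_combination (-(algebraMap O K π ^ (D - k) *
          (coords b X 0 0 + t * coords b X 0 1))) * mul_inv_cancel₀ ht0
      · convert Submodule.sub_mem _ h00 hquot' using 1
        linear_combination (coords b X 0 0 - t⁻¹ * coords b X 1 0) * hq
    lia
  -- The basis `(e₁ + t e₂, e₂)` describes the path from `⟨e₁, e₂⟩` to the given lattice, of length
  -- `k + (c - k) = c`.
  have near : 0 ≤ k → c ≤ D := by
    intro hk0
    obtain ⟨g, -, -, hg⟩ := exists_basis_toMatrix_eq b
      (T := !![1, 0; t, 1]) (S := !![1, 0; -t, 1]) (by simp [Matrix.one_fin_two])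
    refine hmax g c fun X hX => ?_
    obtain ⟨h00, h01, h10, h11⟩ := hb X hX
    obtain ⟨hs00, -, hs10, hs11⟩ := hs X hX
    simp only [hg, Matrix.mul_apply, Fin.sum_univ_two, Matrix.of_apply,
      Matrix.cons_val', Matrix.cons_val_zero, Matrix.cons_val_one, Matrix.cons_val_fin_one]
    refine ⟨?_, ?_, ?_, ?_⟩
    · convert hs00 using 1
      ring
    · convert h01 using 1
      ring
    · convert hs10 using 1
      ring
    · convert hs11 using 1
      ring
  -- If `k < 0`, then `far` would give `c ≤ 2 * k < k`, against `k < c`. So `near` applies, and `k <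
  -- c ≤ D` makes `far` applicable.
  lia

/-- Entrywise description of a closed order with respect to a stable path of maximal length. -/
theorem IsClosedOrder.exists_mem_iff [IsDiscreteValuationRing O] (hπ : Irreducible π)
    (hΛ : IsClosedOrder Λ) :
    ∃ (b : Module.Basis (Fin 2) K (Fin 2 → K)) (D r : ℕ), 2 * r ≤ D ∧ ∀ X, X ∈ Λ ↔
      coords b X 0 0 ∈ mPow K π 0 ∧ coords b X 0 1 ∈ mPow K π 0 ∧ coords b X 1 0 ∈ mPow K π D ∧
        coords b X 1 1 ∈ mPow K π 0 ∧ coords b X 0 0 - coords b X 1 1 ∈ mPow K π r := by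
  classical
  have h0 : algebraMap O K π ≠ 0 := irreducible_map_ne_zero hπ
  obtain ⟨b, D, hb, hmax⟩ := hΛ.1.exists_maximal_isUpperTriangularMod hπ
  let P : ℕ → Prop := fun r =>
    2 * r ≤ D ∧ ∀ X ∈ Λ, coords b X 0 0 - coords b X 1 1 ∈ mPow K π r
  have hP : P 0 := ⟨by lia, fun X hX => Submodule.sub_mem _ (hb X hX).1 (hb X hX).2.2.2⟩
  have hr : P (Nat.findGreatest P D) := Nat.findGreatest_spec (Nat.zero_le D) hP
  have hrmax : ∀ s, P s → s ≤ Nat.findGreatest P D := fun s hs =>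
    Nat.le_findGreatest (by have := hs.1; lia) hs
  generalize Nat.findGreatest P D = r at hr hrmax
  refine ⟨b, D, r, hr.1, fun X => ⟨fun hX => ?_, ?_⟩⟩
  · obtain ⟨h00, h01, h10, h11⟩ := hb X hX
    exact ⟨h00, h01, h10, h11, hr.2 X hX⟩
  · rintro ⟨h00, h01, h10, h11, hd⟩
    -- Closedness enters here: it suffices that `X` stabilizes each lattice that `Λ` stabilizes.
    rw [hΛ.2, mem_PZ]
    intro L hL
    rw [cls_mem_Q] at hL
    obtain ⟨b', rfl⟩ := exists_spanLatt_eq L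
    obtain ⟨t, c, hiff⟩ := exists_stabilizesNormal_iff hπ b b'
    rw [hiff]
    have hs : ∀ Y ∈ Λ, StabilizesNormal π t c (coords b Y) := fun Y hY => (hiff Y).1 (hL hY)
    by_cases ht : t ∈ mPow K π c
    · obtain ⟨hc, hcD⟩ := exponent_mem_Icc_of_maximal hπ hb hmax ht hs
      rw [stabilizesNormal_iff_of_mem hπ ht]
      exact ⟨h00, mPow_antitone hπ (by lia) h01, mPow_antitone hπ hcD h10, h11⟩
    · have ht0 : t ≠ 0 := fun h => ht (h ▸ Submodule.zero_mem _)
      obtain ⟨k, hk, hk', -⟩ := exists_mem_mPow_inv_mem hπ ht0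
      have hkc : k < c := by
        by_contra! h
        exact ht (mPow_antitone hπ h hk)
      obtain ⟨hk0, hcD, hck⟩ := exponent_bounds_of_maximal hπ hb hmax ht0 hk' hkc hs
      have hsq : t ^ 2 ∈ mPow K π c := by
        rw [pow_two]
        exact mPow_mul_mem h0 (by lia) hk hk
      have hsq' : ∀ {y : K}, y ∈ mPow K π 0 → t ^ 2 * y ∈ mPow K π c := fun hy =>
        mPow_mul_mem h0 (by simp) hsq hy
      -- Adding `c ≤ D` and `c ≤ 2 * k` gives `2 * (c - k) ≤ D`. In the third stability condition
      -- for `Y ∈ Λ` the terms `Y₂₁` and `t ^ 2 * Y₁₂` lie in `𝔪 ^ c`, hence so does `t * (Y₂₂ -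
      -- Y₁₁)`. Dividing by `t` gives the congruence modulo `π ^ (c - k)`, and `r` is the largest
      -- such exponent.
      have hcr : c - k ≤ r := by
        obtain ⟨s, hs'⟩ := Int.eq_ofNat_of_zero_le (sub_nonneg.2 hkc.le)
        rw [hs', Int.ofNat_le]
        refine hrmax s ⟨by lia, fun Y hY => ?_⟩
        obtain ⟨-, y01, y10, -⟩ := hb Y hY
        have h := Submodule.sub_mem _ (Submodule.sub_mem _ (mPow_antitone hπ hcD y10) (hsq' y01))
          (hs Y hY).2.2.1
        convert mPow_mul_mem h0 (n := s) (by lia) hk' h using 1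
        field_simp
        ring
      have hmul : t * coords b X 0 1 ∈ mPow K π 0 := mPow_mul_mem h0 (by lia) hk h01
      refine ⟨Submodule.add_mem _ h00 hmul, mPow_antitone hπ (by lia) h01, ?_,
        Submodule.sub_mem _ h11 hmul⟩
      refine Submodule.sub_mem _ (Submodule.add_mem _ (mPow_antitone hπ hcD h10) ?_) (hsq' h01)
      rw [← neg_sub, mul_neg]
      exact Submodule.neg_mem _ (mPow_mul_mem h0 (by lia) hk hd)

end ClosedOrders

end Bolytrope

/-! ### The classification of closed orders in the plane. -/

theorem mainTheorem3 {O K : Type*} [CommRing O] [IsDomain O] [IsDiscreteValuationRing O]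
    [Field K] [Algebra O K] [IsFractionRing O K] {π : O} (hπ : Irreducible π)
    (Λ : Subalgebra O (Matrix (Fin 2) (Fin 2) K)) (hΛ : Bolytrope.IsClosedOrder Λ) :
    ∃ (b : Module.Basis (Fin 2) K (Fin 2 → K)) (r m : ℕ),
      Λ = Bolytrope.bolytropeOrder hπ b r (Bolytrope.upperExponent m) ∧
      (Λ : Set (Matrix (Fin 2) (Fin 2) K)) =
        {X | (∀ i j, Bolytrope.coords b X i j ∈ (algebraMap O K).range) ∧
          Bolytrope.coords b X 0 1 ∈ Bolytrope.mPow K π ((m : ℤ) + r) ∧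
          Bolytrope.coords b X 1 0 ∈ Bolytrope.mPow K π (r : ℤ) ∧
          Bolytrope.coords b X 0 0 - Bolytrope.coords b X 1 1 ∈ Bolytrope.mPow K π (r : ℤ)} := by
  have h0 : algebraMap O K π ≠ 0 := Bolytrope.irreducible_map_ne_zero hπ
  obtain ⟨e, D, r, hrD, hmem⟩ := hΛ.exists_mem_iff hπ
  have hr : algebraMap O K π ^ (r : ℤ) * algebraMap O K π ^ (-(r : ℤ)) = 1 := by
    rw [← zpow_add₀ h0, add_neg_cancel, zpow_zero]
  -- The new basis is `(π ^ r e₂, e₁)`. The swap exchanges the off-diagonal entries, and the scaling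
  -- turns their exponents `D` and `0` into `D - r = m + r` and `r`.
  obtain ⟨b, -, -, hb⟩ := Bolytrope.exists_basis_toMatrix_eq e
    (T := !![0, 1; algebraMap O K π ^ (r : ℤ), 0])
    (S := !![0, algebraMap O K π ^ (-(r : ℤ)); 1, 0]) (by
      rw [Matrix.mul_fin_two, Matrix.one_fin_two, hr]
      simp)
  have key : ∀ X, X ∈ Λ ↔ (∀ i j, Bolytrope.coords b X i j ∈ (algebraMap O K).range) ∧
      Bolytrope.coords b X 0 1 ∈ Bolytrope.mPow K π (((D - 2 * r : ℕ) : ℤ) + r) ∧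
      Bolytrope.coords b X 1 0 ∈ Bolytrope.mPow K π (r : ℤ) ∧
      Bolytrope.coords b X 0 0 - Bolytrope.coords b X 1 1 ∈ Bolytrope.mPow K π (r : ℤ) := by
    intro X
    have c00 : Bolytrope.coords b X 0 0 = Bolytrope.coords e X 1 1 := by
      simp only [hb, Matrix.mul_apply, Fin.sum_univ_two, Matrix.of_apply,
        Matrix.cons_val', Matrix.cons_val_zero, Matrix.cons_val_one, Matrix.cons_val_fin_one]
      linear_combination Bolytrope.coords e X 1 1 * hr
    have c01 : Bolytrope.coords b X 0 1
        = algebraMap O K π ^ (-(r : ℤ)) * Bolytrope.coords e X 1 0 := by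
      simp only [hb, Matrix.mul_apply, Fin.sum_univ_two, Matrix.of_apply,
        Matrix.cons_val', Matrix.cons_val_zero, Matrix.cons_val_one, Matrix.cons_val_fin_one]
      ring
    have c10 : Bolytrope.coords b X 1 0
        = algebraMap O K π ^ (r : ℤ) * Bolytrope.coords e X 0 1 := by
      simp only [hb, Matrix.mul_apply, Fin.sum_univ_two, Matrix.of_apply,
        Matrix.cons_val', Matrix.cons_val_zero, Matrix.cons_val_one, Matrix.cons_val_fin_one]
      ring
    have c11 : Bolytrope.coords b X 1 1 = Bolytrope.coords e X 0 0 := by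
      simp only [hb, Matrix.mul_apply, Fin.sum_univ_two, Matrix.of_apply,
        Matrix.cons_val', Matrix.cons_val_zero, Matrix.cons_val_one, Matrix.cons_val_fin_one]
      ring
    -- The truncated subtraction is exact because `2 * r ≤ D`.
    have hD : ((D - 2 * r : ℕ) : ℤ) + r - -r = D := by lia
    simp only [← Bolytrope.mem_mPow_zero (π := π), Fin.forall_fin_two, hmem, c00, c01, c10, c11,
      Bolytrope.zpow_mul_mem_mPow_iff hπ, hD, sub_self]
    rw [← neg_mem_iff (x := Bolytrope.coords e X 1 1 - Bolytrope.coords e X 0 0), neg_sub]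
    constructor
    · rintro ⟨h00, h01, h10, h11, hd⟩
      exact ⟨⟨⟨h11, Bolytrope.mPow_antitone hπ (by lia) h10⟩,
        Bolytrope.mPow_antitone hπ (by lia) h01, h00⟩, h10, h01, hd⟩
    · rintro ⟨⟨⟨h11, -⟩, -, h00⟩, h10, h01, hd⟩
      exact ⟨h00, h01, h10, h11, hd⟩
  refine ⟨b, r, D - 2 * r, ?_, Set.ext key⟩
  ext X
  rw [key, Bolytrope.mem_bolytropeOrder_upperExponent]
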